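/- **Conventions.** Let $[k]=\{0<1<\dots<k\}$. Let $\square$ be the subcategory of $\mathrm{Cat}$ with objects the posets $[1]^n$, $n\ge 0$, and morphisms generated by the cofaces $[1]^{n}\to[1]^{n+1}$ (insert a constant coordinate), the codegeneracies $[1]^{n+1}\to[1]^{n}$ (drop a coordinate) and the coordinate permutations. A *cubical set* is a presheaf of sets on $\square$; write $\square[1]^n$ for the representable ones and $C_n=C([1]^n)$. For a lattice $L$, $\square[L]$ is the cubical set whose $n$-cubes are the lattice homomorphisms $[1]^n\to L$ sending Boolean intervals onto Boolean intervals. For a small category $\mathcal X$, the *cubical nerve* $\mathrm{ner}\,\mathcal X$ has as $n$-cubes the functors $[1]^n\to\mathcal X$, with $\square$ acting by precomposition. Let $\mathrm{sd}_2$ be the cocontinuous endofunctor of cubical sets with $\mathrm{sd}_2\square[1]^n=\square\big[([1]^n)^{[1]}\big]$ (where $([1]^n)^{[1]}\cong[2]^n$ is the lattice of monotone functions $[1]\to[1]^n$, functorial by post-composition), and let $\mathrm{ex}_2$ be its right adjoint, so $(\mathrm{ex}_2D)_n=\mathrm{Hom}(\mathrm{sd}_2\square[1]^n,D)$. Let $\vec{\mathbb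 I}^n$ be the cube $[0,1]^n$ with its product topology and order, regarded as a stream (a space with a circulation; the stream maps $\vec{\mathbb I}^m\to\vec{\mathbb I}^n$ are precisely the continuous monotone maps); each $\square$-morphism $[1]^m\to[1]^n$ induces the stream map $\vec{\mathbb I}^m\to\vec{\mathbb I}^n$ that is affine and given by that morphism on vertices. For a stream $X$, $\mathrm{sing}\,X$ is the cubical set with $(\mathrm{sing}\,X)_n$ the set of stream maps $\vec{\mathbb I}^n\to X$. Let $(-)^\sharp$ be the left Kan extension of $[1]^n\mapsto\mathrm{sing}\,\vec{\mathbb I}^n$ along the Yoneda embedding $[1]^n\mapsto\square[1]^n$. It comes with a natural map $\eta_C:C\to C^\sharp$, which for $C=\square[1]^n$ sends a cube to the stream map that it induces, and a natural map $\varphi_C:C^\sharp\to\mathrm{ex}_2C^\sharp$, which for $C=\square[1]^n$ sends a stream map $\theta:\vec{\mathbb I}^m\to\vec{\mathbb I}^n$ to the cubical function $\mathrm{sd}_2\square[1]^m\to\mathrm{sing}\,\vec{\mathbb I}^n$ taking a cube $\psi:[1]^p\to([1]^m)^{[1]}\cong[2]^m$ to $\theta\circ|\psi|$, where $|\psi|:\vec{\mathbb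 I}^p\to\vec{\mathbb I}^m$ is the affine map with $|\psi|(v)=\psi(v)/2$ on vertices $v$. For a small category $\mathcal G$, a *$\mathcal G$-category* (resp. *$\mathcal G$-cubical set*) is a functor from $\mathcal G$ to small categories (resp. cubical sets), and $\mathcal G$-cubical functions are natural transformations; the constructions above apply objectwise. A $\mathcal G$-cubical set $C$ is a *$\mathcal G$-cubcat* if there exist $\mathcal G$-cubical functions $\rho:C^\sharp\to C$ and $\mu:\mathrm{ex}_2C\to C$ such that $$\rho\circ\eta_C=1_C\qquad\text{and}\qquad \mu\circ\mathrm{ex}_2(\rho)\circ\varphi_C=\rho .$$ **Proposition.** For every small category $\mathcal G$ and every $\mathcal G$-category $\mathcal X$, the $\mathcal G$-cubical set $\mathrm{ner}\,\mathcal X$ is a $\mathcal G$-cubcat. -/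

import Mathlib

open CategoryTheory

universe u v₁ u₁

noncomputable section

namespace Cubcat

/-- The Boolean lattice `[1]ⁿ` with the product order. -/
abbrev Box (n : ℕ) : Type := Fin n → Fin 2

/-- The poset `[1]ⁿ` regarded as a category. -/
instance (n : ℕ) : SmallCategory (Box n) := Preorder.smallCategory (Box n)

/-- The coface `δ_{±i} : [1]ⁿ → [1]ⁿ⁺¹`, inserting the value `e` as the `i`-th coordinate. -/
def Box.coface {n : ℕ} (i : Fin (n + 1)) (e : Fin 2) : Box n →o Box (n + 1) where
  toFun x := Fin.insertNth (α := fun _ => Fin 2) i e x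
  monotone' x y h j := by
    rcases Fin.eq_self_or_eq_succAbove i j with rfl | ⟨j, rfl⟩
    · simp
    · simpa using h j

/-- The codegeneracy `σ_i : [1]ⁿ⁺¹ → [1]ⁿ`, the projection onto all but the `i`-th factor. -/
def Box.codegeneracy {n : ℕ} (i : Fin (n + 1)) : Box (n + 1) →o Box n where
  toFun x j := x (i.succAbove j)
  monotone' _ _ h j := h (i.succAbove j)

/-- A coordinate permutation of `[1]ⁿ`. -/
def Box.permute {n : ℕ} (s : Equiv.Perm (Fin n)) : Box n →o Box n where
  toFun x j := x (s j)
  monotone' _ _ h j := h (s j)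

/-- The monotone functions `[1]ᵐ → [1]ⁿ` generated under composition by the cofaces, the
codegeneracies and the coordinate permutations. -/
inductive IsCubeMap : ∀ {m n : ℕ}, (Box m →o Box n) → Prop
  | ident (n : ℕ) : IsCubeMap (OrderHom.id (α := Box n))
  | comp {l m n : ℕ} (f : Box l →o Box m) (g : Box m →o Box n) :
      IsCubeMap f → IsCubeMap g → IsCubeMap (g.comp f)
  | coface {n : ℕ} (i : Fin (n + 1)) (e : Fin 2) : IsCubeMap (Box.coface i e)
  | codegeneracy {n : ℕ} (i : Fin (n + 1)) : IsCubeMap (Box.codegeneracy i)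
  | permute {n : ℕ} (s : Equiv.Perm (Fin n)) : IsCubeMap (Box.permute s)

/-- Objects of the (symmetric) cube category `□`: the object of dimension `n` is `[1]ⁿ`. -/
structure Cube : Type where
  dim : ℕ

/-- The cube category `□`, the subcategory of `Cat` with objects `[1]ⁿ` and morphisms generated by
cofaces, codegeneracies and coordinate permutations. -/
instance : SmallCategory Cube where
  Hom a b := {f : Box a.dim →o Box b.dim // IsCubeMap f}
  id a := ⟨OrderHom.id, .ident _⟩
  comp f g := ⟨g.1.comp f.1, .comp _ _ f.2 g.2⟩

/-- Cubical sets: presheaves on `□`. -/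
abbrev CubicalSet : Type (u + 1) := Cubeᵒᵖ ⥤ Type u

/-- Intervals in a lattice: order-convex subsets with a minimum and a maximum. -/
def IsInterval {L : Type} [Lattice L] (S : Set L) : Prop := ∃ a b : L, a ≤ b ∧ S = Set.Icc a b

/-- Boolean intervals: intervals that are order-isomorphic to a power set. -/
def IsBooleanInterval {L : Type} [Lattice L] (S : Set L) : Prop :=
  IsInterval S ∧ ∃ α : Type, Nonempty (S ≃o Set α)

/-- Images of Boolean intervals are Boolean intervals. -/
def PreservesBooleanIntervals {L M : Type} [Lattice L] [Lattice M] (f : LatticeHom L M) : Prop :=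
  ∀ S : Set L, IsBooleanInterval S → IsBooleanInterval (f '' S)

/-- A coordinate of `x`, or a constant. -/
def Box.read {m : ℕ} (x : Box m) : Fin m ⊕ Fin 2 → Fin 2
  | .inl j => x j
  | .inr e => e

theorem IsCubeMap.coordinates {m n : ℕ} {f : Box m →o Box n} (hf : IsCubeMap f) :
    ∃ g : Fin n → Fin m ⊕ Fin 2, (∀ i j k, g i = .inl k → g j = .inl k → i = j) ∧
      ∀ x i, f x i = Box.read x (g i) := by
  induction hf with
  | ident n => exact ⟨Sum.inl, by simp +contextual, fun x i => rfl⟩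
  | comp f g _ _ hf hg =>
    obtain ⟨a, ha, ha'⟩ := hf
    obtain ⟨b, hb, hb'⟩ := hg
    refine ⟨fun i => Sum.elim a Sum.inr (b i), fun i j k hi hj => ?_, fun x i => ?_⟩
    · cases hbi : b i <;> cases hbj : b j <;> simp [hbi, hbj] at hi hj
      have := ha _ _ _ hi hj
      exact hb _ _ _ hbi (this ▸ hbj)
    · change g (f x) i = _
      rw [hb']
      cases hbi : b i with
      | inl j => simpa [hbi, Box.read] using ha' x j
      | inr e => simp [hbi, Box.read]
  | @coface n i e =>
    refine ⟨Fin.insertNth (α := fun _ => Fin n ⊕ Fin 2) i (Sum.inr e) Sum.inl, fun j l k => ?_,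
      fun x j => ?_⟩
    · rcases Fin.eq_self_or_eq_succAbove i j with rfl | ⟨j, rfl⟩
      · simp
      · rcases Fin.eq_self_or_eq_succAbove i l with rfl | ⟨l, rfl⟩ <;> simp +contextual
    · rcases Fin.eq_self_or_eq_succAbove i j with rfl | ⟨j, rfl⟩ 
      · change Fin.insertNth (α := fun _ => Fin 2) j e x j = _
        simp [Box.read]
      · change Fin.insertNth (α := fun _ => Fin 2) i e x (i.succAbove j) = _
        simp [Box.read]
  | codegeneracy i =>
    exact ⟨fun j => .inl (i.succAbove j), by simp +contextual [← Fin.succAbove_right_inj (p := i)], fun x j => rfl⟩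
  | permute s =>
    exact ⟨fun j => .inl (s j), fun i j k hi hj => s.injective (by simp_all), fun x j => rfl⟩

/-- Post-composition `f ∘ - : ([1]ᵐ)ᴷ → ([1]ⁿ)ᴷ` with a cube map `f`, on lattices of monotone
functions out of `K` with the pointwise order. -/
def postcomp {K : Type} [Preorder K] {m n : ℕ} (f : Box m →o Box n) (hf : IsCubeMap f) :
    LatticeHom (K →o Box m) (K →o Box n) where
  toFun z := f.comp z
  map_sup' x y := by
    obtain ⟨g, -, hg⟩ := hf.coordinates
    ext k : 2
    funext i
    change f (x k ⊔ y k) i = f (x k) i ⊔ f (y k) i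
    rw [hg, hg, hg]
    cases g i with
    | inl j => rfl
    | inr j => exact (sup_idem j).symm
  map_inf' x y := by
    obtain ⟨g, -, hg⟩ := hf.coordinates
    ext k : 2
    funext i
    change f (x k ⊓ y k) i = f (x k) i ⊓ f (y k) i
    rw [hg, hg, hg]
    cases g i with
    | inl j => rfl
    | inr j => exact (inf_idem j).symm

theorem preservesBooleanIntervals_of_Icc {L M : Type} [Lattice L] [Lattice M] [Finite M]
    (hd : ∀ x y z : M, (x ⊔ y) ⊓ (x ⊔ z) ≤ x ⊔ y ⊓ z) (f : LatticeHom L M)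
    (h : ∀ a b y, a ≤ b → f a ≤ y → y ≤ f b → ∃ x, a ≤ x ∧ x ≤ b ∧ f x = y) :
    PreservesBooleanIntervals f := by
  classical
  rintro S ⟨⟨a, b, hab, rfl⟩, α, ⟨e⟩⟩
  have hmono : Monotone f := OrderHomClass.mono f
  have himg : f '' Set.Icc a b = Set.Icc (f a) (f b) := by
    ext y
    constructor
    · rintro ⟨x, hx, rfl⟩
      exact ⟨hmono hx.1, hmono hx.2⟩
    · rintro ⟨h1, h2⟩
      obtain ⟨x, hx1, hx2, rfl⟩ := h a b y hab h1 h2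
      exact ⟨x, ⟨hx1, hx2⟩, rfl⟩
  refine ⟨⟨f a, f b, hmono hab, himg⟩, ?_⟩
  rw [himg]
  have := Fact.mk hab
  have := Fact.mk (hmono hab)
  have hc : ComplementedLattice (Set.Icc a b) := (e.complementedLattice_iff).2 inferInstance
  have hc' : ComplementedLattice (Set.Icc (f a) (f b)) := by
    constructor
    rintro ⟨y, hy1, hy2⟩
    obtain ⟨x, hx1, hx2, rfl⟩ := h a b y hab hy1 hy2
    obtain ⟨⟨z, hz⟩, hzc⟩ := hc.exists_isCompl ⟨x, hx1, hx2⟩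
    refine ⟨⟨f z, hmono hz.1, hmono hz.2⟩, ?_⟩
    rw [isCompl_iff, disjoint_iff, codisjoint_iff] at hzc ⊢
    refine ⟨Subtype.ext ?_, Subtype.ext ?_⟩
    · have := congrArg (fun t => f t.1) hzc.1
      exact (map_inf f x z).symm.trans this
    · have := congrArg (fun t => f t.1) hzc.2
      exact (map_sup f x z).symm.trans this
  let _ : DistribLattice (Set.Icc (f a) (f b)) :=
    { (inferInstance : Lattice (Set.Icc (f a) (f b))) with
      le_sup_inf := fun x y z => hd x.1 y.1 z.1 }
  let _ : BooleanAlgebra (Set.Icc (f a) (f b)) :=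
    DistribLattice.booleanAlgebraOfComplemented _
  let _ := Fintype.ofFinite (Set.Icc (f a) (f b))
  let _ : CompleteAtomicBooleanAlgebra (Set.Icc (f a) (f b)) :=
    Fintype.toCompleteAtomicBooleanAlgebra _
  exact ⟨_, ⟨CompleteAtomicBooleanAlgebra.toSetOfIsAtom⟩⟩

theorem postcomp_surj {K : Type} [Preorder K] {m n : ℕ} (f : Box m →o Box n) (hf : IsCubeMap f)
    (a b : K →o Box m) (y : K →o Box n) (hab : a ≤ b) (h1 : f.comp a ≤ y) (h2 : y ≤ f.comp b) :
    ∃ x, a ≤ x ∧ x ≤ b ∧ f.comp x = y := by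
  classical
  obtain ⟨g, hg, hfg⟩ := hf.coordinates
  have h1' : ∀ k i, Box.read (a k) (g i) ≤ y k i := fun k i => by
    rw [← hfg]; exact h1 k i
  have h2' : ∀ k i, y k i ≤ Box.read (b k) (g i) := fun k i => by
    rw [← hfg]; exact h2 k i
  let x : K → Box m := fun k j => if h : ∃ i, g i = .inl j then y k h.choose else a k j
  have hx : ∀ k i j, g i = .inl j → x k j = y k i := fun k i j hij => by
    have h : ∃ i, g i = .inl j := ⟨i, hij⟩
    have : h.choose = i := hg _ _ _ h.choose_spec hij
    simp only [x, dif_pos h, this]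
  have hx' : ∀ k j, (¬ ∃ i, g i = .inl j) → x k j = a k j := fun k j h => by simp only [x, dif_neg h]
  refine ⟨⟨x, fun k l hkl j => ?_⟩, fun k j => ?_, fun k j => ?_, ?_⟩
  · by_cases h : ∃ i, g i = .inl j
    · obtain ⟨i, hi⟩ := h
      rw [hx _ _ _ hi, hx _ _ _ hi]
      exact y.monotone hkl i
    · rw [hx' _ _ h, hx' _ _ h]
      exact a.monotone hkl j
  · change a k j ≤ x k j
    by_cases h : ∃ i, g i = .inl j
    · obtain ⟨i, hi⟩ := h
      rw [hx _ _ _ hi]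
      have := h1' k i
      rwa [hi] at this
    · rw [hx' _ _ h]
  · change x k j ≤ b k j
    by_cases h : ∃ i, g i = .inl j
    · obtain ⟨i, hi⟩ := h
      rw [hx _ _ _ hi]
      have := h2' k i
      rwa [hi] at this
    · rw [hx' _ _ h]
      exact hab k j
  · ext k : 2
    funext i
    change f (x k) i = _
    rw [hfg]
    cases hi : g i with
    | inl j => exact hx _ _ _ hi
    | inr e =>
      have h1 := h1' k i
      have h2 := h2' k i
      rw [hi] at h1 h2
      exact le_antisymm h1 h2

instance {K : Type} [Preorder K] [Finite K] {m : ℕ} : Finite (K →o Box m) :=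
  Finite.of_injective (fun f : K →o Box m => (f : K → Box m)) DFunLike.coe_injective

theorem postcomp_preserves {K : Type} [Preorder K] [Finite K] {m n : ℕ} (f : Box m →o Box n)
    (hf : IsCubeMap f) : PreservesBooleanIntervals (postcomp (K := K) f hf) :=
  preservesBooleanIntervals_of_Icc (fun x y z k => le_sup_inf (x := x k) (y := y k) (z := z k))
    (postcomp (K := K) f hf) fun a b y hab h1 h2 =>
    postcomp_surj f hf a b y hab h1 h2

/-- A cube map as a lattice homomorphism. -/
def IsCubeMap.latticeHom {m n : ℕ} {f : Box m →o Box n} (hf : IsCubeMap f) :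
    LatticeHom (Box m) (Box n) where
  toFun := f
  map_sup' x y := congrArg (fun z : Unit →o Box n => z ())
    (map_sup (postcomp (K := Unit) f hf) (OrderHom.const _ x) (OrderHom.const _ y))
  map_inf' x y := congrArg (fun z : Unit →o Box n => z ())
    (map_inf (postcomp (K := Unit) f hf) (OrderHom.const _ x) (OrderHom.const _ y))

theorem IsCubeMap.preserves {m n : ℕ} {f : Box m →o Box n} (hf : IsCubeMap f) :
    PreservesBooleanIntervals hf.latticeHom :=
  preservesBooleanIntervals_of_Icc (fun _ _ _ => le_sup_inf) hf.latticeHom fun a b y hab h1 h2 => by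
    change f a ≤ y at h1
    change y ≤ f b at h2
    obtain ⟨x, hx1, hx2, hx3⟩ := postcomp_surj (K := Unit) f hf (OrderHom.const _ a)
      (OrderHom.const _ b) (OrderHom.const _ y) (fun _ => hab) (fun _ => h1) (fun _ => h2)
    exact ⟨x (), hx1 (), hx2 (), congrArg (fun z : Unit →o Box n => z ()) hx3⟩

theorem PreservesBooleanIntervals.comp {L M N : Type} [Lattice L] [Lattice M] [Lattice N]
    {g : LatticeHom M N} {f : LatticeHom L M} (hg : PreservesBooleanIntervals g)
    (hf : PreservesBooleanIntervals f) : PreservesBooleanIntervals (g.comp f) := fun S hS => by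
  have := hg _ (hf S hS)
  rwa [Set.image_image] at this

/-- The cubical set `□[L]` of a lattice `L`: its `n`-cubes are the lattice homomorphisms `[1]ⁿ → L`
that preserve Boolean intervals, and `□` acts by precomposition. -/
def latticeCubes (L : Type) [Lattice L] : CubicalSet.{u} where
  obj n := ULift.{u} {f : LatticeHom (Box n.unop.dim) L // PreservesBooleanIntervals f}
  map p := TypeCat.ofHom fun f => ⟨f.down.1.comp p.unop.2.latticeHom, f.down.2.comp p.unop.2.preserves⟩

/-- The cubical function `□[g] : □[L] → □[M]`. -/
def latticeCubesMap {L M : Type} [Lattice L] [Lattice M] (g : LatticeHom L M)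
    (hg : PreservesBooleanIntervals g) : latticeCubes.{u} L ⟶ latticeCubes.{u} M where
  app n := TypeCat.ofHom fun f => ⟨g.comp f.down.1, hg.comp f.down.2⟩

/-- The `(k+1)`-fold edgewise subdivision of cubes, `[1]ⁿ ↦ □[([1]ⁿ)^[k]]`, where `[k]` is
`Fin (k + 1)`. -/
def sdCube (k : ℕ) : Cube ⥤ CubicalSet.{u} where
  obj n := latticeCubes (Fin (k + 1) →o Box n.dim)
  map p := latticeCubesMap (postcomp p.1 p.2) (postcomp_preserves p.1 p.2)

/-- The relation `(C(p) x, a) ∼ (x, A(p) a)` of the coend `∫ⁿ C_n × A([1]ⁿ)`. -/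
inductive KanRel (A : Cube ⥤ CubicalSet.{u}) (C : CubicalSet.{u}) (m : Cubeᵒᵖ) :
    (Σ n : Cube, C.obj (.op n) × (A.obj n).obj m) →
    (Σ n : Cube, C.obj (.op n) × (A.obj n).obj m) → Prop
  | intro {n n' : Cube} (p : n ⟶ n') (x : C.obj (.op n')) (a : (A.obj n).obj m) :
      KanRel A C m ⟨n, C.map p.op x, a⟩ ⟨n', x, (A.map p).app m a⟩

/-- The cocontinuous extension `C ↦ ∫ⁿ C_n × A([1]ⁿ)` of a functor `A` on `□`: the pointwise left
Kan extension of `A` along the Yoneda embedding. -/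
def kan (A : Cube ⥤ CubicalSet.{u}) : CubicalSet.{u} ⥤ CubicalSet.{u} where
  obj C :=
    { obj := fun m => Quot (KanRel A C m)
      map := fun {m m'} q => TypeCat.ofHom (Quot.map (fun t => ⟨t.1, t.2.1, (A.obj t.1).map q t.2.2⟩) (by
        rintro _ _ ⟨p, x, a⟩
        have := NatTrans.naturality_apply (A.map p) q a
        simp only [← this]
        exact .intro p x _))
      map_id := fun m => by
        ext ⟨t⟩
        simp [Quot.map]
      map_comp := fun f g => by
        ext ⟨t⟩
        simp [Quot.map] }
  map {C D} f :=
    { app := fun m => TypeCat.ofHom (Quot.map (fun t => ⟨t.1, f.app _ t.2.1, t.2.2⟩) (by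
        rintro _ _ ⟨p, x, a⟩
        have := NatTrans.naturality_apply f p.op x
        simp only [this]
        exact .intro p _ a))
      naturality := fun m m' q => by
        ext ⟨t⟩
        rfl }
  map_id C := by
    ext m ⟨t⟩
    simp [Quot.map]
  map_comp f g := by
    ext m ⟨t⟩
    simp [Quot.map]

/-- The cubical function `A([1]ⁿ) → kan A C` belonging to an `n`-cube `x` of `C`. -/
def kanIncl (A : Cube ⥤ CubicalSet.{u}) (C : CubicalSet.{u}) {n : Cube} (x : C.obj (.op n)) :
    A.obj n ⟶ (kan A).obj C where
  app m := TypeCat.ofHom fun a => Quot.mk _ ⟨n, x, a⟩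

/-- The functor `D ↦ Hom(A(-), D)`. -/
def nerveOf (A : Cube ⥤ CubicalSet.{u}) : CubicalSet.{u} ⥤ CubicalSet.{u} :=
  yoneda ⋙ (Functor.whiskeringLeft _ _ _).obj A.op

/-- The cocontinuous extension of `A` is left adjoint to `D ↦ Hom(A(-), D)`. -/
def kanAdj (A : Cube ⥤ CubicalSet.{u}) : kan A ⊣ nerveOf A :=
  Adjunction.mkOfHomEquiv
    { homEquiv := fun C D =>
        { toFun := fun f =>
            { app := fun n => TypeCat.ofHom fun x => kanIncl A C x ≫ f
              naturality := fun n n' p => by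
                ext x
                apply NatTrans.ext
                funext m
                ext a
                exact congrArg (f.app m) (Quot.sound (.intro p.unop x a)) }
          invFun := fun g =>
            { app := fun m => TypeCat.ofHom (Quot.lift (fun t => (g.app _ t.2.1).app m t.2.2) (by
                rintro _ _ ⟨p, x, a⟩
                exact congrArg (fun h : A.obj _ ⟶ D => h.app m a) (NatTrans.naturality_apply g p.op x)))
              naturality := fun m m' q => by
                ext ⟨t⟩
                exact NatTrans.naturality_apply (g.app _ t.2.1) q t.2.2 }
          left_inv := fun f => by
            ext m ⟨t⟩
            rfl
          right_inv := fun g => by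
            ext n x
            rfl }
      homEquiv_naturality_left_symm := fun f g => by
        ext m ⟨t⟩
        rfl
      homEquiv_naturality_right := fun f g => by
        ext n x
        rfl }

/-- The cubical nerve: `(ner C)_n` is the set of functors `[1]ⁿ → C`, and `□` acts by precomposition. -/
def ner : Cat.{u, u} ⥤ CubicalSet.{u} where
  obj C :=
    { obj := fun n => Box n.unop.dim ⥤ C
      map := fun p => TypeCat.ofHom fun F => p.unop.1.monotone.functor ⋙ F }
  map G := { app := fun n => TypeCat.ofHom fun F => F ⋙ G.toFunctor }

/-- A circulation on `X`: a preorder `≤_U` on each open `U`, such that the preorder on a union of open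
subsets is the smallest one that contains the preorders on these subsets. -/
structure Circulation (X : Type) [TopologicalSpace X] where
  le : TopologicalSpace.Opens X → X → X → Prop
  mem_of_le : ∀ {U x y}, le U x y → x ∈ U ∧ y ∈ U
  refl : ∀ {U x}, x ∈ U → le U x x
  trans : ∀ {U x y z}, le U x y → le U y z → le U x z
  le_sSup_iff : ∀ (S : Set (TopologicalSpace.Opens X)) (x y : X), le (sSup S) x y ↔
    x ∈ sSup S ∧ Relation.ReflTransGen (fun a b => ∃ U ∈ S, le U a b) x y

/-- Streams: topological spaces with a circulation.  The weak Hausdorff k-streams form a full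
subcategory that contains all directed cubes. -/
structure Strm : Type 1 where
  carrier : Type
  [top : TopologicalSpace carrier]
  circ : Circulation carrier

attribute [instance] Strm.top

/-- Stream maps: continuous maps `f` with `f x ≤_U f y` whenever `x ≤_{f⁻¹ U} y`. -/
@[ext]
structure StrmHom (X Y : Strm) where
  toFun : X.carrier → Y.carrier
  continuous_toFun : Continuous toFun
  map_le : ∀ (U : TopologicalSpace.Opens Y.carrier) (x y : X.carrier),
    X.circ.le (U.comap ⟨toFun, continuous_toFun⟩) x y → Y.circ.le U (toFun x) (toFun y)

instance : Category Strm where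
  Hom := StrmHom
  id X := ⟨id, continuous_id, fun _ _ _ h => h⟩
  comp f g := ⟨g.toFun ∘ f.toFun, g.continuous_toFun.comp f.continuous_toFun,
    fun U x y h => g.map_le U _ _ (f.map_le _ x y h)⟩

/-- The cube `𝕀ⁿ` with the product topology and the product order. -/
abbrev ICube (n : ℕ) : Type := Fin n → unitInterval

/-- The relation `x ≤_U y` in the directed cube: `x` and `y` are joined by an ascending chain whose
consecutive members `a ≤ b` satisfy `[a, b] ⊆ U`. -/
def ICube.Le {n : ℕ} (U : TopologicalSpace.Opens (ICube n)) (x y : ICube n) : Prop :=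
  x ∈ U ∧ Relation.ReflTransGen (fun a b : ICube n => a ≤ b ∧ Set.Icc a b ⊆ U) x y

theorem ICube.exists_convex_nhd {n : ℕ} (U : Set (ICube n)) (hU : IsOpen U) (x : ICube n) (hx : x ∈ U) :
    ∃ V : Set (ICube n), IsOpen V ∧ V.OrdConnected ∧ x ∈ V ∧ V ⊆ U := by
  obtain ⟨r, hr, hball⟩ := Metric.isOpen_iff.1 hU x hx
  refine ⟨Metric.ball x r, Metric.isOpen_ball, ⟨fun a ha c hc b hb => ?_⟩, Metric.mem_ball_self hr, hball⟩
  rw [Metric.mem_ball, dist_pi_lt_iff hr] at *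
  intro i
  have h1 := abs_lt.1 (ha i)
  have h2 := abs_lt.1 (hc i)
  have h3 : (a i : ℝ) ≤ b i := hb.1 i
  have h4 : (b i : ℝ) ≤ c i := hb.2 i
  change |(b i : ℝ) - x i| < r
  exact abs_lt.2 ⟨by linarith, by linarith⟩

theorem ICube.chain {n : ℕ} (S : Set (TopologicalSpace.Opens (ICube n))) (a b : ICube n) (hab : a ≤ b)
    (h : Set.Icc a b ⊆ (sSup S : TopologicalSpace.Opens (ICube n))) :
    Relation.ReflTransGen (fun a b => ∃ U ∈ S, ICube.Le U a b) a b := by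
  have hseg : ∀ (t : unitInterval) (i : Fin n),
      (a i : ℝ) + t * (b i - a i) ∈ Set.Icc (a i : ℝ) (b i) := fun t i => by
    have h1 : (a i : ℝ) ≤ b i := hab i
    have h2 := t.2.1
    have h3 := t.2.2
    constructor <;> nlinarith
  let γ : unitInterval → ICube n := fun t i =>
    ⟨(a i : ℝ) + t * (b i - a i), (a i).2.1.trans (hseg t i).1, (hseg t i).2.trans (b i).2.2⟩
  have hγ : Continuous γ := by fun_prop
  have hγm : Monotone γ := fun s t hst i => by
    have h1 : (a i : ℝ) ≤ b i := hab i
    have h2 : (s : ℝ) ≤ t := hst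
    change (a i : ℝ) + s * (b i - a i) ≤ (a i : ℝ) + t * (b i - a i)
    nlinarith
  have hγ0 : γ 0 = a := by
    funext i; apply Subtype.ext; simp [γ]
  have hγ1 : γ 1 = b := by
    funext i; apply Subtype.ext; simp [γ]
  let ι := {V : Set (ICube n) // IsOpen V ∧ V.OrdConnected ∧ ∃ U ∈ S, V ⊆ (U : Set (ICube n))}
  obtain ⟨t, ht0, htm, ⟨N, hN⟩, ht⟩ := exists_monotone_Icc_subset_open_cover_unitInterval
    (c := fun V : ι => γ ⁻¹' V.1) (fun V => V.2.1.preimage hγ) (by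
      intro s _
      have : γ s ∈ sSup S := h ⟨fun i => (hseg s i).1, fun i => (hseg s i).2⟩
      obtain ⟨U, hU, hs⟩ := TopologicalSpace.Opens.mem_sSup.1 this
      obtain ⟨V, hV1, hV2, hV3, hV4⟩ := ICube.exists_convex_nhd (U : Set (ICube n)) U.2 _ hs
      exact Set.mem_iUnion.2 ⟨⟨V, hV1, hV2, U, hU, hV4⟩, hV3⟩)
  have key : ∀ m, Relation.ReflTransGen (fun a b => ∃ U ∈ S, ICube.Le U a b) a (γ (t m)) := by
    intro m
    induction m with
    | zero => rw [ht0, hγ0]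
    | succ m ih =>
      refine ih.tail ?_
      obtain ⟨⟨V, hV1, hV2, U, hU, hVU⟩, hV⟩ := ht m
      have hm := htm m.le_succ
      have e1 : γ (t m) ∈ V := hV ⟨le_rfl, hm⟩
      have e2 : γ (t (m + 1)) ∈ V := hV ⟨hm, le_rfl⟩
      exact ⟨U, hU, hVU e1, .single ⟨hγm hm, (hV2.out e1 e2).trans hVU⟩⟩
  have := key N
  rwa [hN N le_rfl, hγ1] at this

theorem ICube.Le.mem {n : ℕ} {U : TopologicalSpace.Opens (ICube n)} {x y : ICube n} (h : ICube.Le U x y) :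
    x ∈ U ∧ y ∈ U := by
  refine ⟨h.1, ?_⟩
  obtain ⟨hx, h⟩ := h
  induction h with
  | refl => exact hx
  | tail _ h _ => exact h.2 ⟨h.1, le_rfl⟩

theorem ICube.Le.trans {n : ℕ} {U : TopologicalSpace.Opens (ICube n)} {x y z : ICube n}
    (h : ICube.Le U x y) (h' : ICube.Le U y z) : ICube.Le U x z := ⟨h.1, h.2.trans h'.2⟩

theorem ICube.Le.le {n : ℕ} {U : TopologicalSpace.Opens (ICube n)} {x y : ICube n} (h : ICube.Le U x y) :
    x ≤ y := by
  obtain ⟨-, h⟩ := h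
  induction h with
  | refl => exact le_rfl
  | tail _ h ih => exact ih.trans h.1

theorem ICube.Le.mono {n : ℕ} {U V : TopologicalSpace.Opens (ICube n)} {x y : ICube n}
    (h : ICube.Le U x y) (hUV : U ≤ V) : ICube.Le V x y :=
  ⟨hUV h.1, h.2.lift id fun _ _ hab => ⟨hab.1, hab.2.trans hUV⟩⟩

/-- The circulation of the pospace `𝕀ⁿ`; on the whole cube it is the product order. -/
def ICube.circulation (n : ℕ) : Circulation (ICube n) where
  le := ICube.Le
  mem_of_le h := h.mem
  refl h := ⟨h, .refl⟩
  trans h h' := h.trans h'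
  le_sSup_iff S x y := by
    constructor
    · rintro ⟨hx, h⟩
      refine ⟨hx, ?_⟩
      induction h with
      | refl => exact .refl
      | tail _ h ih => exact ih.trans (ICube.chain S _ _ h.1 h.2)
    · rintro ⟨hx, h⟩
      induction h with
      | refl => exact ⟨hx, .refl⟩
      | tail _ h ih =>
        obtain ⟨U, hU, h⟩ := h
        exact ih.trans (h.mono (le_sSup hU))

/-- The directed cube, the directed realization of `□[1]ⁿ`. -/
def dirCube (n : ℕ) : Strm where
  carrier := ICube n
  circ := ICube.circulation n

/-- Monotone continuous maps between cubes are stream maps. -/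
def dirCubeMap {m n : ℕ} (f : ICube m → ICube n) (hc : Continuous f) (hm : Monotone f) :
    dirCube m ⟶ dirCube n where
  toFun := f
  continuous_toFun := hc
  map_le U x y h := by
    let S : Set (TopologicalSpace.Opens (ICube m)) :=
      {W | ∃ V : TopologicalSpace.Opens (ICube n), (V : Set (ICube n)).OrdConnected ∧ V ≤ U ∧
        W = V.comap ⟨f, hc⟩}
    have hS : U.comap ⟨f, hc⟩ = sSup S := by
      apply le_antisymm
      · intro x hx
        obtain ⟨V, hV1, hV2, hV3, hV4⟩ := ICube.exists_convex_nhd (U : Set (dirCube n).carrier) U.2 (f x) hx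
        exact TopologicalSpace.Opens.mem_sSup.2 ⟨_, ⟨⟨V, hV1⟩, hV2, hV4, rfl⟩, hV3⟩
      · apply sSup_le
        rintro _ ⟨V, -, hVU, rfl⟩ x hx
        exact hVU hx
    change ICube.Le (U.comap ⟨f, hc⟩) x y at h
    change ICube.Le U (f x) (f y)
    have hx : f x ∈ U := h.1
    rw [hS] at h
    have := (((ICube.circulation m).le_sSup_iff S x y).1 h).2
    clear h
    induction this with
    | refl => exact ⟨hx, .refl⟩
    | tail _ h ih =>
      obtain ⟨_, ⟨V, hV, hVU, rfl⟩, h⟩ := h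
      refine ih.trans ⟨hVU h.mem.1, .single ⟨hm h.le, ?_⟩⟩
      exact (hV.out h.mem.1 h.mem.2).trans hVU

/-- The affine function on `ℝᵐ` that agrees with `g` at the origin and the unit vectors.  It agrees with
`g` on all vertices when `g` is modular, see `affExt_vertex`. -/
def affExt {m : ℕ} (g : Box m → ℝ) (t : Fin m → ℝ) : ℝ :=
  g ⊥ + ∑ j, t j * (g (Pi.single j 1) - g ⊥)

/-- The functions on vertices whose affine extension is monotone, with values in `𝕀`, and has the
prescribed values on all vertices. -/
structure IsVertexMap {m : ℕ} (g : Box m → ℝ) : Prop where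
  mono : Monotone g
  modular : ∀ x y, g (x ⊔ y) + g (x ⊓ y) = g x + g y
  mem : ∀ x, g x ∈ unitInterval

/-- The vertex of `𝕀ᵐ` given by an element of `[1]ᵐ`. -/
def Box.toReal {m : ℕ} (v : Box m) (j : Fin m) : ℝ := ((v j : ℕ) : ℝ)

theorem affExt_vertex {m : ℕ} {g : Box m → ℝ} (hg : IsVertexMap g) (v : Box m) :
    affExt g v.toReal = g v := by
  classical
  let w : Finset (Fin m) → Box m := fun s j => if j ∈ s then 1 else 0
  have key : ∀ s : Finset (Fin m), g (w s) = g ⊥ + ∑ j ∈ s, (g (Pi.single j 1) - g ⊥) := by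
    intro s
    induction s using Finset.induction_on with
    | empty => simp [w]; rfl
    | insert a s ha ih =>
      have h1 : w s ⊔ Pi.single a 1 = w (insert a s) := by
        funext j
        by_cases hj : j = a
        · subst hj; simp [w, ha]
        · simp [w, hj]
      have h2 : w s ⊓ Pi.single a 1 = ⊥ := by
        funext j
        change w s j ⊓ (Pi.single a 1 : Box m) j = 0
        by_cases hj : j = a
        · subst hj; simp [w, ha]
        · simp [w, hj]
      have := hg.modular (w s) (Pi.single a 1)
      rw [h1, h2, ih] at this
      rw [Finset.sum_insert ha]
      linarith
  have hv : v = w (Finset.univ.filter fun j => v j = 1) := by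
    funext j
    simp only [w, Finset.mem_filter, Finset.mem_univ, true_and]
    generalize v j = e
    fin_cases e <;> simp
  rw [affExt]
  conv_rhs => rw [hv, key, Finset.sum_filter]
  congr 1
  refine Finset.sum_congr rfl fun j _ => ?_
  simp only [Box.toReal]
  generalize v j = e
  fin_cases e <;> simp

theorem affExt_mono {m : ℕ} {g : Box m → ℝ} (hg : IsVertexMap g) : Monotone (affExt g) := fun s t h => by
  refine add_le_add_right (Finset.sum_le_sum fun j _ => mul_le_mul_of_nonneg_right (h j) ?_) _
  exact sub_nonneg.2 (hg.mono bot_le)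

theorem affExt_mem {m : ℕ} {g : Box m → ℝ} (hg : IsVertexMap g) (t : ICube m) :
    affExt g (fun j => (t j : ℝ)) ∈ unitInterval := by
  constructor
  · refine (hg.mem ⊥).1.trans ?_
    rw [← affExt_vertex hg]
    exact affExt_mono hg fun j => by simpa [Box.toReal] using (t j).2.1
  · refine le_trans ?_ (hg.mem ⊤).2
    rw [← affExt_vertex hg]
    refine affExt_mono hg fun j => (t j).2.2.trans ?_
    change (1 : ℝ) ≤ ((1 : ℕ) : ℝ)
    simp

/-- The stream map of directed cubes that is affine with the given values on the vertices. -/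
def affMap {m n : ℕ} (g : Fin n → Box m → ℝ) (hg : ∀ i, IsVertexMap (g i)) : dirCube m ⟶ dirCube n :=
  dirCubeMap (fun t i => ⟨affExt (g i) (fun j => (t j : ℝ)), affExt_mem (hg i) t⟩)
    (by unfold affExt; fun_prop)
    (fun _ _ h i => affExt_mono (hg i) fun j => h j)

theorem affMap_comp {l m n : ℕ} (g : Fin m → Box l → ℝ) (hg : ∀ i, IsVertexMap (g i))
    (h : Fin n → Box m → ℝ) (hh : ∀ i, IsVertexMap (h i))
    (k : Fin n → Box l → ℝ) (hk : ∀ i, IsVertexMap (k i))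
    (e : ∀ i v, k i v = affExt (h i) (fun j => g j v)) :
    affMap g hg ≫ affMap h hh = affMap k hk := by
  apply StrmHom.ext
  funext t i
  apply Subtype.ext
  change affExt (h i) (fun j => affExt (g j) fun j => (t j : ℝ)) = affExt (k i) fun j => (t j : ℝ)
  conv_rhs => rw [affExt]
  simp only [e]
  simp only [affExt, add_mul, Finset.sum_add_distrib, Finset.mul_sum, Finset.sum_mul, add_sub_add_left_eq_sub, ← Finset.sum_sub_distrib, ← add_assoc]
  congr 1
  rw [Finset.sum_comm]
  refine Finset.sum_congr rfl fun a _ => Finset.sum_congr rfl fun b _ => ?_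
  ring

theorem isVertexMap_avg {k m : ℕ} (h : Fin (k + 1) → Box m → Fin 2)
    (hsup : ∀ i x y, h i (x ⊔ y) = h i x ⊔ h i y) (hinf : ∀ i x y, h i (x ⊓ y) = h i x ⊓ h i y) :
    IsVertexMap fun v => (∑ i, ((h i v : ℕ) : ℝ)) / (k + 1) where
  mono x y hxy := by
    refine div_le_div_of_nonneg_right (Finset.sum_le_sum fun i _ => ?_) (by positivity)
    have := hsup i x y
    rw [sup_eq_right.2 hxy] at this
    have h2 : h i x ≤ h i y := by rw [this]; exact le_sup_left
    exact_mod_cast h2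
  modular x y := by
    rw [← add_div, ← add_div, ← Finset.sum_add_distrib, ← Finset.sum_add_distrib]
    congr 1
    refine Finset.sum_congr rfl fun i _ => ?_
    rw [hsup, hinf]
    rcases le_total (h i x) (h i y) with hle | hle
    · rw [sup_eq_right.2 hle, inf_eq_left.2 hle, add_comm]
    · rw [sup_eq_left.2 hle, inf_eq_right.2 hle]
  mem x := by
    constructor
    · positivity
    · rw [div_le_one (by positivity)]
      calc (∑ i, ((h i x : ℕ) : ℝ)) ≤ ∑ _i : Fin (k + 1), (1 : ℝ) :=
            Finset.sum_le_sum fun i _ => by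
              have := (h i x).isLt
              have h2 : (h i x : ℕ) ≤ 1 := by omega
              exact_mod_cast h2
        _ = k + 1 := by simp

theorem isVertexMap_coord {m : ℕ} (h : Box m → Fin 2)
    (hsup : ∀ x y, h (x ⊔ y) = h x ⊔ h y) (hinf : ∀ x y, h (x ⊓ y) = h x ⊓ h y) :
    IsVertexMap fun v => ((h v : ℕ) : ℝ) := by
  simpa using isVertexMap_avg (k := 0) (fun _ => h) (fun _ => hsup) (fun _ => hinf)

theorem IsCubeMap.isVertexMap {m n : ℕ} {f : Box m →o Box n} (hf : IsCubeMap f) (i : Fin n) :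
    IsVertexMap fun v => ((f v i : ℕ) : ℝ) :=
  isVertexMap_coord (fun v => f v i) (fun x y => congrFun (map_sup hf.latticeHom x y) i)
    (fun x y => congrFun (map_inf hf.latticeHom x y) i)

/-- The directed realization of representables, `[1]ⁿ ↦ 𝕀ⁿ`: a cube map goes to the affine map that it
prescribes on vertices. -/
def realize : Cube ⥤ Strm where
  obj n := dirCube n.dim
  map p := affMap (fun i v => ((p.1 v i : ℕ) : ℝ)) p.2.isVertexMap
  map_id n := by
    apply StrmHom.ext
    funext t i
    apply Subtype.ext
    change affExt (fun v : Box n.dim => ((v i : ℕ) : ℝ)) (fun j => (t j : ℝ)) = t i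
    rw [affExt, Finset.sum_eq_single i]
    · simp
    · intro j _ hj
      simp [hj.symm]
    · simp
  map_comp p q := by
    symm
    refine affMap_comp _ _ _ _ _ _ fun i v => ?_
    exact (affExt_vertex (q.2.isVertexMap i) (p.1 v)).symm

/-- Directed singular cubical sets: `(sing X)_n` is the set of stream maps `𝕀ⁿ → X`. -/
def sing : Strm ⥤ CubicalSet.{u} where
  obj X :=
    { obj := fun n => ULift.{u} (realize.obj n.unop ⟶ X)
      map := fun p => TypeCat.ofHom fun f => ⟨realize.map p.unop ≫ f.down⟩
      map_id := fun n => by ext f; simp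
      map_comp := fun p q => by ext f; simp }
  map h := { app := fun n => TypeCat.ofHom fun f => ⟨f.down ≫ h⟩ }

theorem isVertexMap_sd {k p m : ℕ} (f : LatticeHom (Box p) (Fin (k + 1) →o Box m)) (j : Fin m) :
    IsVertexMap fun v => (∑ i, ((f v i j : ℕ) : ℝ)) / (k + 1) :=
  isVertexMap_avg (fun i v => f v i j)
    (fun i x y => congrArg (fun z : Fin (k + 1) →o Box m => z i j) (map_sup f x y))
    (fun i x y => congrArg (fun z : Fin (k + 1) →o Box m => z i j) (map_inf f x y))

/-- For a `p`-cube `f` of `sd_{k+1} □[1]ᵐ`, the composite of the realization of `f` with the canonical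
isomorphism from the realization of `sd_{k+1} □[1]ᵐ` to that of `□[1]ᵐ`.  That isomorphism is linear
on each cell and sends a vertex `z` of `([1]ᵐ)^[k] ≅ [k+1]ᵐ`, with coordinates `∑ i, z i j`, to the
point with coordinates `(∑ i, z i j) / (k + 1)`. -/
def sdRealize {k : ℕ} {p m : Cube} (f : LatticeHom (Box p.dim) (Fin (k + 1) →o Box m.dim)) :
    realize.obj p ⟶ realize.obj m :=
  affMap (fun j v => (∑ i, ((f v i j : ℕ) : ℝ)) / (k + 1)) (isVertexMap_sd f)

theorem sdRealize_precomp {k : ℕ} {q p m : Cube} (r : q ⟶ p)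
    (f : LatticeHom (Box p.dim) (Fin (k + 1) →o Box m.dim)) :
    sdRealize (f.comp r.2.latticeHom) = realize.map r ≫ sdRealize f := by
  symm
  refine affMap_comp _ r.2.isVertexMap _ _ _ _ fun i v => ?_
  exact (affExt_vertex (isVertexMap_sd f i) (r.1 v)).symm

theorem sdRealize_postcomp {k : ℕ} {p m n : Cube} (r : m ⟶ n)
    (f : LatticeHom (Box p.dim) (Fin (k + 1) →o Box m.dim)) :
    sdRealize ((postcomp r.1 r.2).comp f) = sdRealize f ≫ realize.map r := by
  symm
  refine affMap_comp _ _ _ r.2.isVertexMap _ _ fun i v => ?_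
  have h : ∀ l, ((r.1 (f v l) i : ℕ) : ℝ) = affExt (fun w => ((r.1 w i : ℕ) : ℝ)) (f v l).toReal :=
    fun l => (affExt_vertex (r.2.isVertexMap i) (f v l)).symm
  change (∑ l, ((r.1 (f v l) i : ℕ) : ℝ)) / (k + 1) = _
  simp only [h]
  simp only [affExt, Box.toReal, Finset.sum_add_distrib, add_div, Finset.sum_const, Finset.card_univ,
    Fintype.card_fin, nsmul_eq_mul, Nat.cast_add, Nat.cast_one]
  rw [mul_div_cancel_left₀ _ (by positivity), Finset.sum_comm, Finset.sum_div]
  congr 1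
  refine Finset.sum_congr rfl fun a _ => ?_
  rw [← Finset.sum_mul]
  ring

/-- The `(k+1)`-fold subdivision of cubical sets. -/
def sd (k : ℕ) : CubicalSet.{u} ⥤ CubicalSet.{u} := kan (sdCube k)

/-- The right adjoint of `(k+1)`-fold subdivision, so that `ex 1` extends over two-fold subdivisions. -/
def ex (k : ℕ) : CubicalSet.{u} ⥤ CubicalSet.{u} := nerveOf (sdCube k)

/-- `ex` is right adjoint to `sd`. -/
def sdAdj (k : ℕ) : sd.{u} k ⊣ ex.{u} k := kanAdj (sdCube k)

/-- The functor `C ↦ C^♯`, the left Kan extension along the Yoneda embedding of the functor sending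
`[1]ⁿ` to the singular cubical set of its directed realization. -/
def sharp : CubicalSet.{u} ⥤ CubicalSet.{u} := kan (realize ⋙ sing)

/-- The unit `C → C^♯`, which on representables is the unit of the adjunction between directed
realization and `sing`. -/
def sharpUnit : 𝟭 CubicalSet.{u} ⟶ sharp.{u} where
  app C :=
    { app := fun n => TypeCat.ofHom fun x => Quot.mk _ ⟨n.unop, x, ⟨𝟙 _⟩⟩
      naturality := fun n n' p => by
        ext x
        refine (Quot.sound (KanRel.intro (A := realize ⋙ sing.{u}) (C := C) (m := n') p.unop x
          (ULift.up (𝟙 (realize.obj n'.unop))))).trans ?_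
        apply congrArg (Quot.mk _)
        change (⟨n.unop, x, ⟨𝟙 _ ≫ realize.map p.unop⟩⟩ :
          Σ l : Cube, C.obj (.op l) × ((realize ⋙ sing.{u}).obj l).obj n') =
          ⟨n.unop, x, ⟨realize.map p.unop ≫ 𝟙 _⟩⟩
        rw [Category.id_comp, Category.comp_id] }

/-- A stream map `f` from the realization of `□[1]ᵐ` to `X`, precomposed with the canonical isomorphism
from the realization of `sd_{k+1} □[1]ᵐ`, as a cubical function from `sd_{k+1} □[1]ᵐ` to `sing X`. -/
def dihomeoSing (k : ℕ) (m : Cube) {X : Strm} (f : realize.obj m ⟶ X) :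
    (sdCube.{u} k).obj m ⟶ sing.{u}.obj X where
  app p := TypeCat.ofHom fun c => ⟨sdRealize c.down.1 ≫ f⟩
  naturality p p' r := by
    ext c
    apply ULift.ext
    change sdRealize (c.down.1.comp r.unop.2.latticeHom) ≫ f = realize.map r.unop ≫ sdRealize c.down.1 ≫ f
    rw [sdRealize_precomp, Category.assoc]

/-- The cubical function `C^♯ → ex_{k+1} (C^♯)`, natural in `C`, induced on each piece
`sing 𝕀ⁿ → ex_{k+1} (sing 𝕀ⁿ)` of `C^♯` by precomposition with the canonical isomorphisms from the
realizations of subdivided cubes. -/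
def dihomeoSharp (k : ℕ) : sharp.{u} ⟶ sharp.{u} ⋙ ex.{u} k where
  app C :=
    { app := fun m => TypeCat.ofHom (Quot.lift
        (fun t => dihomeoSing k m.unop t.2.2.down ≫ kanIncl (realize ⋙ sing) C t.2.1) (by
          rintro _ _ ⟨p, x, a⟩
          apply NatTrans.ext
          funext q
          ext c
          exact Quot.sound (KanRel.intro (A := realize ⋙ sing.{u}) (C := C) (m := q) p x
            (ULift.up (sdRealize c.down.1 ≫ a.down)))))
      naturality := fun m m' r => by
        ext ⟨t⟩
        apply NatTrans.ext
        funext q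
        ext c
        change Quot.mk _ _ = Quot.mk _ _
        apply congrArg (Quot.mk _)
        change (⟨t.1, t.2.1, ⟨sdRealize c.down.1 ≫ realize.map r.unop ≫ t.2.2.down⟩⟩ :
          Σ n : Cube, C.obj (.op n) × ((realize ⋙ sing.{u}).obj n).obj q) =
          ⟨t.1, t.2.1, ⟨sdRealize ((postcomp r.unop.1 r.unop.2).comp c.down.1) ≫ t.2.2.down⟩⟩
        rw [sdRealize_postcomp, Category.assoc] }
  naturality C D f := by
    ext m ⟨t⟩
    rfl

/-- A `G`-cubical set is a `G`-cubcat if there are a retraction `r` of the unit into `C^♯` and a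
composition map `c : ex_2 C → C` such that `c ∘ ex_2 r` precomposed with `C^♯ → ex_2 (C^♯)` is `r`. -/
def IsCubcat {G : Type u₁} [Category.{v₁} G] (C : G ⥤ CubicalSet.{u}) : Prop :=
  ∃ (r : C ⋙ sharp ⟶ C) (c : C ⋙ ex 1 ⟶ C),
    (∀ g, sharpUnit.app (C.obj g) ≫ r.app g = 𝟙 (C.obj g)) ∧
    ∀ g, (dihomeoSharp 1).app (C.obj g) ≫ (ex 1).map (r.app g) ≫ c.app g = r.app g

end Cubcat

end

noncomputable section

namespace Cubcat

theorem exists_isCubeMap_update {n : ℕ} (i : Fin n) (e : Fin 2) :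
    ∃ f : Box n →o Box n, IsCubeMap f ∧ ∀ x, f x = Function.update x i e := by
  cases n with
  | zero => exact i.elim0
  | succ n =>
    refine ⟨(Box.coface i e).comp (Box.codegeneracy i), .comp _ _ (.codegeneracy i) (.coface i e),
      fun x => ?_⟩
    funext j
    change Fin.insertNth (α := fun _ => Fin 2) i e (fun l => x (i.succAbove l)) j = _
    rcases Fin.eq_self_or_eq_succAbove i j with rfl | ⟨j, rfl⟩
    · simp
    · simp [Fin.succAbove_ne]

theorem exists_isCubeMap_piecewise {n : ℕ} (s : Finset (Fin n)) (c : Box n) :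
    ∃ f : Box n →o Box n, IsCubeMap f ∧ ∀ x j, f x j = if j ∈ s then c j else x j := by
  classical
  induction s using Finset.induction_on with
  | empty => exact ⟨_, .ident n, by simp⟩
  | insert a s _ ih =>
    obtain ⟨f, hf, hfx⟩ := ih
    obtain ⟨g, hg, hgx⟩ := exists_isCubeMap_update a (c a)
    refine ⟨g.comp f, .comp _ _ hf hg, fun x j => ?_⟩
    change g (f x) j = _
    rw [hgx]
    by_cases hj : j = a
    · subst hj; simp
    · simp [hj, hfx]

/-- The endomorphism of `[1]ⁿ` that maps it onto the interval `[x, y]` when `x ≤ y`. -/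
def Box.between {n : ℕ} (x y : Box n) : Box n →o Box n where
  toFun w := x ⊔ w ⊓ y
  monotone' _ _ h := sup_le_sup_left (inf_le_inf_right _ h) _

theorem Box.isCubeMap_between {n : ℕ} (x y : Box n) : IsCubeMap (Box.between x y) := by
  obtain ⟨f, hf, hfx⟩ := exists_isCubeMap_piecewise
    (Finset.univ.filter fun j => x j = 1 ∨ y j = 0) x
  convert hf
  ext w : 2
  funext j
  rw [hfx]
  change x j ⊔ w j ⊓ y j = _
  simp only [Finset.mem_filter, Finset.mem_univ, true_and]
  generalize x j = p, w j = q, y j = r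
  revert p q r
  decide

/-- The lattice `([1]ⁿ)^[1]`. -/
abbrev Grid (n : ℕ) : Type := Fin (1 + 1) →o Box n

/-- The order relations `a ≤ b` in `([1]ⁿ)^[1] ≅ [2]ⁿ` whose coordinates differ by at most one. -/
def Grid.Adjacent {n : ℕ} (a b : Grid n) : Prop :=
  a ≤ b ∧ ∀ j, a 0 j = b 0 j ∨ a 1 j = b 1 j

theorem Grid.Adjacent.refl {n : ℕ} (a : Grid n) : a.Adjacent a := ⟨le_rfl, fun _ => .inl rfl⟩

theorem Grid.Adjacent.of_le {n : ℕ} {a b c d : Grid n} (h : a.Adjacent d) (hab : a ≤ b)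
    (hbc : b ≤ c) (hcd : c ≤ d) : b.Adjacent c :=
  ⟨hbc, fun j => (h.2 j).imp
    (fun e => le_antisymm (hbc 0 j) ((hcd 0 j).trans (e.symm.le.trans (hab 0 j))))
    (fun e => le_antisymm (hbc 1 j) ((hcd 1 j).trans (e.symm.le.trans (hab 1 j))))⟩

/-- The cube of `([1]ⁿ)^[1]` with extreme vertices `a` and `b`. -/
def gridCube {n : ℕ} (a b : Grid n) : LatticeHom (Box n) (Grid n) where
  toFun x := a ⊔ OrderHom.const _ x ⊓ b
  map_sup' x y := by
    ext k : 2
    funext j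
    change a k j ⊔ (x j ⊔ y j) ⊓ b k j = (a k j ⊔ x j ⊓ b k j) ⊔ (a k j ⊔ y j ⊓ b k j)
    rw [inf_sup_right, sup_sup_distrib_left]
  map_inf' x y := by
    ext k : 2
    funext j
    change a k j ⊔ (x j ⊓ y j) ⊓ b k j = (a k j ⊔ x j ⊓ b k j) ⊓ (a k j ⊔ y j ⊓ b k j)
    rw [← sup_inf_left, ← inf_inf_distrib_right]

theorem gridCube_apply {n : ℕ} (a b : Grid n) (x : Box n) (k : Fin (1 + 1)) (j : Fin n) :
    gridCube a b x k j = a k j ⊔ x j ⊓ b k j := rfl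

theorem gridCube_mono {n : ℕ} (a b : Grid n) : Monotone (gridCube a b) :=
  OrderHomClass.mono (gridCube a b)

theorem gridCube_bot {n : ℕ} (a b : Grid n) : gridCube a b ⊥ = a := by
  ext k : 2
  funext j
  change a k j ⊔ (⊥ : Fin 2) ⊓ b k j = a k j
  rw [bot_inf_eq, sup_bot_eq]

theorem gridCube_top {n : ℕ} {a b : Grid n} (h : a ≤ b) : gridCube a b ⊤ = b := by
  ext k : 2
  funext j
  change a k j ⊔ (⊤ : Fin 2) ⊓ b k j = b k j
  rw [top_inf_eq, sup_eq_right]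
  exact h k j

theorem sup_inf_right_self {L : Type*} [Lattice L] (a z : L) : a ⊔ z ⊓ a = a :=
  sup_eq_left.2 inf_le_right

theorem fin_two_interval_surj : ∀ a b y p q : Fin 2, a ⊔ p ⊓ b ≤ y → y ≤ a ⊔ q ⊓ b → p ≤ q →
    ∃ z, p ≤ z ∧ z ≤ q ∧ a ⊔ z ⊓ b = y := by
  intro a b y p q h1 h2 h3
  rcases h1.eq_or_lt with h | h
  · exact ⟨p, le_rfl, h3, h⟩
  · refine ⟨q, h3, le_rfl, le_antisymm ?_ h2⟩
    have : y = 1 := by omega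
    exact this ▸ Fin.le_last _

theorem gridCube_surj {n : ℕ} {a b : Grid n} (h : a.Adjacent b) (x x' : Box n) (y : Grid n)
    (hx : x ≤ x') (h1 : gridCube a b x ≤ y) (h2 : y ≤ gridCube a b x') :
    ∃ z, x ≤ z ∧ z ≤ x' ∧ gridCube a b z = y := by
  have key : ∀ j, ∃ z, x j ≤ z ∧ z ≤ x' j ∧ a 0 j ⊔ z ⊓ b 0 j = y 0 j ∧
      a 1 j ⊔ z ⊓ b 1 j = y 1 j := fun j => by
    have e1 : a 0 j ⊔ x j ⊓ b 0 j ≤ y 0 j := h1 0 j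
    have e2 : a 1 j ⊔ x j ⊓ b 1 j ≤ y 1 j := h1 1 j
    have e3 : y 0 j ≤ a 0 j ⊔ x' j ⊓ b 0 j := h2 0 j
    have e4 : y 1 j ≤ a 1 j ⊔ x' j ⊓ b 1 j := h2 1 j
    rcases h.2 j with e | e
    · obtain ⟨z, hz1, hz2, hz⟩ := fin_two_interval_surj _ _ _ _ _ e2 e4 (hx j)
      rw [← e, sup_inf_right_self] at e1 e3
      exact ⟨z, hz1, hz2, by rw [← e, sup_inf_right_self]; exact le_antisymm e1 e3, hz⟩
    · obtain ⟨z, hz1, hz2, hz⟩ := fin_two_interval_surj _ _ _ _ _ e1 e3 (hx j)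
      rw [← e, sup_inf_right_self] at e2 e4
      exact ⟨z, hz1, hz2, hz, by rw [← e, sup_inf_right_self]; exact le_antisymm e2 e4⟩
  choose z hz1 hz2 hz3 hz4 using key
  refine ⟨z, hz1, hz2, ?_⟩
  ext k : 2
  funext j
  rw [gridCube_apply]
  fin_cases k
  · exact hz3 j
  · exact hz4 j

theorem gridCube_preserves {n : ℕ} {a b : Grid n} (h : a.Adjacent b) :
    PreservesBooleanIntervals (gridCube a b) :=
  preservesBooleanIntervals_of_Icc (fun x y z k => le_sup_inf (x := x k) (y := y k) (z := z k))
    _ fun x x' y hx h1 h2 => gridCube_surj h x x' y hx h1 h2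

theorem gridCube_adjacent {n : ℕ} {a b : Grid n} (h : a.Adjacent b) {x y : Box n} (hxy : x ≤ y) :
    (gridCube a b x).Adjacent (gridCube a b y) := by
  refine h.of_le ?_ (gridCube_mono a b hxy) ?_
  · exact le_sup_left
  · exact sup_le h.1 inf_le_right

theorem gridCube_between {n : ℕ} (a b : Grid n) (x y w : Box n) :
    gridCube a b (Box.between x y w) = gridCube (gridCube a b x) (gridCube a b y) w := by
  ext k : 2
  funext j
  change a k j ⊔ (x j ⊔ w j ⊓ y j) ⊓ b k j =
    (a k j ⊔ x j ⊓ b k j) ⊔ w j ⊓ (a k j ⊔ y j ⊓ b k j)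
  generalize a k j = a, b k j = b, x j = x, y j = y, w j = w
  revert a b x y w
  decide

theorem postcomp_gridCube {m n : ℕ} (f : Box m →o Box n) (hf : IsCubeMap f) (a b : Grid m)
    (x : Box m) : f.comp (gridCube a b x) = gridCube (f.comp a) (f.comp b) (f x) := by
  obtain ⟨g, -, hg⟩ := hf.coordinates
  ext k : 2
  funext i
  change f (gridCube a b x k) i = f (a k) i ⊔ f x i ⊓ f (b k) i
  simp only [hg]
  cases g i with
  | inl j => rfl
  | inr e => simp [Box.read]

theorem Grid.Adjacent.comp {m n : ℕ} {f : Box m →o Box n} (hf : IsCubeMap f) {a b : Grid m}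
    (h : a.Adjacent b) : Grid.Adjacent (f.comp a) (f.comp b) := by
  obtain ⟨g, -, hg⟩ := hf.coordinates
  refine ⟨fun k => f.monotone (h.1 k), fun i => ?_⟩
  change f (a 0) i = f (b 0) i ∨ f (a 1) i = f (b 1) i
  simp only [hg]
  cases g i with
  | inl j => exact h.2 j
  | inr e => exact .inl rfl

section Edges

variable {X : Cat.{u, u}} {m : Cube} (α : (sdCube.{u} 1).obj m ⟶ ner.obj X)

/-- The value of a cubical function `sd_2 □[1]ᵐ → ner X` at the cube with extreme vertices `a`, `b`. -/
def cubeFunctor (a b : Grid m.dim) (h : a.Adjacent b) : Box m.dim ⥤ X :=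
  α.app (.op m) ⟨⟨gridCube a b, gridCube_preserves h⟩⟩

theorem cubeFunctor_between (a b : Grid m.dim) (h : a.Adjacent b) {x y : Box m.dim} (hxy : x ≤ y) :
    cubeFunctor α (gridCube a b x) (gridCube a b y) (gridCube_adjacent h hxy) =
      (Box.between x y).monotone.functor ⋙ cubeFunctor α a b h := by
  let p : m ⟶ m := ⟨Box.between x y, Box.isCubeMap_between x y⟩
  refine Eq.trans ?_ (NatTrans.naturality_apply α p.op
    (⟨⟨gridCube a b, gridCube_preserves h⟩⟩ : ULift {f : LatticeHom (Box m.dim) (Grid m.dim) // PreservesBooleanIntervals f}))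
  apply congrArg (α.app (.op m))
  apply ULift.ext
  apply Subtype.ext
  apply LatticeHom.ext
  intro w
  exact (gridCube_between a b x y w).symm

/-- The value of a cubical function `sd_2 □[1]ᵐ → ner X` at a vertex. -/
def vertexObj (a : Grid m.dim) : X := (cubeFunctor α a a (.refl a)).obj ⊥

theorem between_bot {n : ℕ} (x y : Box n) : Box.between x y ⊥ = x := by
  funext j
  change x j ⊔ (⊥ : Fin 2) ⊓ y j = x j
  rw [bot_inf_eq, sup_bot_eq]

theorem between_top {n : ℕ} {x y : Box n} (h : x ≤ y) : Box.between x y ⊤ = y := by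
  funext j
  change x j ⊔ (⊤ : Fin 2) ⊓ y j = y j
  rw [top_inf_eq, sup_eq_right]
  exact h j

theorem cubeFunctor_obj {a b : Grid m.dim} (h : a.Adjacent b) (x : Box m.dim) :
    (cubeFunctor α a b h).obj x = vertexObj α (gridCube a b x) := by
  have := Functor.congr_obj (cubeFunctor_between α a b h (le_refl x)) ⊥
  refine Eq.trans ?_ this.symm
  change _ = (cubeFunctor α a b h).obj (Box.between x x ⊥)
  rw [between_bot]

theorem cubeFunctor_obj' {a b c : Grid m.dim} (h : a.Adjacent b) (x : Box m.dim)
    (hc : c = gridCube a b x) : (cubeFunctor α a b h).obj x = vertexObj α c := by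
  rw [hc, cubeFunctor_obj]

/-- The diagonal of the cube with extreme vertices `a`, `b`. -/
def diagonal {a b : Grid m.dim} (h : a.Adjacent b) : vertexObj α a ⟶ vertexObj α b :=
  eqToHom (cubeFunctor_obj' α h ⊥ (gridCube_bot a b).symm).symm ≫
    (cubeFunctor α a b h).map (homOfLE bot_le : (⊥ : Box m.dim) ⟶ ⊤) ≫
    eqToHom (cubeFunctor_obj' α h ⊤ (gridCube_top h.1).symm)

theorem map_eq_of_eq_comp {B C D : Type*} [Category B] [Category C] [Category D]
    (hC : ∀ x y : C, Subsingleton (x ⟶ y)) {K : B ⥤ D} {H : B ⥤ C} {F : C ⥤ D} (e : K = H ⋙ F)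
    {u v : B} (g : u ⟶ v) {x y : C} (f : x ⟶ y) (hx : H.obj u = x) (hy : H.obj v = y) :
    K.map g = eqToHom ((Functor.congr_obj e u).trans (congrArg F.obj hx)) ≫ F.map f ≫
      eqToHom ((Functor.congr_obj e v).trans (congrArg F.obj hy)).symm := by
  subst e hx hy
  simp [(hC _ _).elim f (H.map g)]

theorem cubeFunctor_map {a b c d : Grid m.dim} (h : a.Adjacent b) {x y : Box m.dim} (f : x ⟶ y)
    (hc : c = gridCube a b x) (hd : d = gridCube a b y) (hcd : c.Adjacent d) :
    (cubeFunctor α a b h).map f = eqToHom (cubeFunctor_obj' α h x hc) ≫ diagonal α hcd ≫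
      eqToHom (cubeFunctor_obj' α h y hd).symm := by
  subst hc hd
  have hxy : x ≤ y := leOfHom f
  rw [diagonal, map_eq_of_eq_comp (fun _ _ => inferInstance) (cubeFunctor_between α a b h hxy) _ f
    (between_bot x y) (between_top hxy)]
  simp

theorem diagonal_self (a : Grid m.dim) (h : a.Adjacent a) : diagonal α h = 𝟙 _ := by
  have := cubeFunctor_map α h (𝟙 ⊥) (gridCube_bot a a).symm (gridCube_bot a a).symm h
  rw [CategoryTheory.Functor.map_id] at this
  rw [← cancel_epi (eqToHom (cubeFunctor_obj' α h ⊥ (gridCube_bot a a).symm)),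
    ← cancel_mono (eqToHom (cubeFunctor_obj' α h ⊥ (gridCube_bot a a).symm).symm)]
  rw [Category.assoc, ← this]
  simp

theorem diagonal_comp {a b c : Grid m.dim} (hab : a.Adjacent b) (hbc : b.Adjacent c)
    (hac : a.Adjacent c) : diagonal α hab ≫ diagonal α hbc = diagonal α hac := by
  obtain ⟨z, -, -, hz⟩ := gridCube_surj hac ⊥ ⊤ b bot_le (by rw [gridCube_bot]; exact hab.1)
    (by rw [gridCube_top hac.1]; exact hbc.1)
  have e : (homOfLE bot_le : (⊥ : Box m.dim) ⟶ ⊤) =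
    (homOfLE bot_le : (⊥ : Box m.dim) ⟶ z) ≫ (homOfLE le_top : z ⟶ ⊤) := Subsingleton.elim _ _
  rw [diagonal.eq_1 α hac, e, Functor.map_comp,
    cubeFunctor_map α hac _ (gridCube_bot a c).symm hz.symm hab,
    cubeFunctor_map α hac _ hz.symm (gridCube_top hac.1).symm hbc]
  simp

end Edges

/-- The element `(v, w)` of `([1]ⁿ)^[1]`. -/
def Grid.pair {n : ℕ} (v w : Box n) (h : v ≤ w) : Grid n where
  toFun k := if k = 0 then v else w
  monotone' k l hkl := by
    dsimp only
    split_ifs with h1 h2 h2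
    · exact le_rfl
    · exact h
    · subst h2; exact absurd (le_antisymm hkl (Fin.zero_le k)) h1
    · exact le_rfl

theorem Grid.pair_le {n : ℕ} {v w v' w' : Box n} {h : v ≤ w} {h' : v' ≤ w'} (hv : v ≤ v')
    (hw : w ≤ w') : Grid.pair v w h ≤ Grid.pair v' w' h' := fun k => by
  change (if k = 0 then v else w) ≤ if k = 0 then v' else w'
  split_ifs
  · exact hv
  · exact hw

theorem Grid.pair_adjacent {n : ℕ} {v w v' w' : Box n} (h : v ≤ w) (h' : v' ≤ w') (hv : v ≤ v')
    (hw : w ≤ w') (hj : ∀ j, v j = v' j ∨ w j = w' j) :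
    (Grid.pair v w h).Adjacent (Grid.pair v' w' h') :=
  ⟨Grid.pair_le hv hw, hj⟩

theorem Grid.comp_pair {m n : ℕ} (f : Box m →o Box n) {v w : Box m} (h : v ≤ w) :
    f.comp (Grid.pair v w h) = Grid.pair (f v) (f w) (f.monotone h) := by
  ext k : 2
  exact apply_ite f _ _ _

theorem Grid.pair_self_adjacent {n : ℕ} {v w : Box n} (h : v ≤ w) :
    (Grid.pair v v le_rfl).Adjacent (Grid.pair v w h) :=
  Grid.pair_adjacent _ _ le_rfl h fun _ => .inl rfl

theorem Grid.pair_adjacent_self {n : ℕ} {v w : Box n} (h : v ≤ w) :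
    (Grid.pair v w h).Adjacent (Grid.pair w w le_rfl) :=
  Grid.pair_adjacent _ _ h le_rfl fun _ => .inr rfl

theorem fin_two_eq_or_eq : ∀ a b c : Fin 2, a ≤ b → b ≤ c → a = b ∨ b = c := by decide

section Edges

variable {X : Cat.{u, u}} {m : Cube} (α : (sdCube.{u} 1).obj m ⟶ ner.obj X)

/-- The composite cube of a cubical function `sd_2 □[1]ᵐ → ner X`. -/
def compositeCube : Box m.dim ⥤ X where
  obj v := vertexObj α (Grid.pair v v le_rfl)
  map {v w} f := diagonal α (Grid.pair_self_adjacent (leOfHom f)) ≫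
    diagonal α (Grid.pair_adjacent_self (leOfHom f))
  map_id v := by rw [diagonal_self, Category.comp_id]
  map_comp {u v w} f g := by
    have huv : u ≤ v := leOfHom f
    have hvw : v ≤ w := leOfHom g
    have huw := huv.trans hvw
    have h1 : (Grid.pair u v huv).Adjacent (Grid.pair u w huw) :=
      Grid.pair_adjacent _ _ le_rfl hvw fun _ => .inl rfl
    have h2 : (Grid.pair u w huw).Adjacent (Grid.pair v w hvw) :=
      Grid.pair_adjacent _ _ huv le_rfl fun _ => .inr rfl
    have h3 : (Grid.pair u v huv).Adjacent (Grid.pair v w hvw) :=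
      Grid.pair_adjacent _ _ huv hvw fun j => fin_two_eq_or_eq _ _ _ (huv j) (hvw j)
    rw [← diagonal_comp α (Grid.pair_self_adjacent huv) h1,
      ← diagonal_comp α h2 (Grid.pair_adjacent_self hvw), Category.assoc, Category.assoc,
      ← Category.assoc (diagonal α h1), diagonal_comp α h1 h2 h3,
      ← diagonal_comp α (Grid.pair_adjacent_self huv) (Grid.pair_self_adjacent hvw) h3]
    simp only [Category.assoc]

end Edges

section Naturality

variable {X Y : Cat.{u, u}} {m m' : Cube}

theorem cubeFunctor_postcomp (α : (sdCube.{u} 1).obj m ⟶ ner.obj X) (f : m' ⟶ m)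
    {a b : Grid m'.dim} (h : a.Adjacent b) :
    cubeFunctor ((sdCube 1).map f ≫ α) a b h =
      f.1.monotone.functor ⋙ cubeFunctor α (f.1.comp a) (f.1.comp b) (h.comp f.2) := by
  refine Eq.trans ?_ (NatTrans.naturality_apply α f.op
    (⟨⟨gridCube (f.1.comp a) (f.1.comp b), gridCube_preserves (h.comp f.2)⟩⟩ :
      ULift {f : LatticeHom (Box m.dim) (Grid m.dim) // PreservesBooleanIntervals f}))
  apply congrArg (α.app (.op m'))
  apply ULift.ext
  apply Subtype.ext
  apply LatticeHom.ext
  intro w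
  exact postcomp_gridCube f.1 f.2 a b w

theorem vertexObj_postcomp (α : (sdCube.{u} 1).obj m ⟶ ner.obj X) (f : m' ⟶ m)
    (a : Grid m'.dim) :
    vertexObj ((sdCube 1).map f ≫ α) a = vertexObj α (f.1.comp a) := by
  refine (Functor.congr_obj (cubeFunctor_postcomp α f (.refl a)) ⊥).trans ?_
  refine cubeFunctor_obj' α _ (f.1 ⊥) ?_
  rw [← postcomp_gridCube f.1 f.2, gridCube_bot]

theorem diagonal_postcomp (α : (sdCube.{u} 1).obj m ⟶ ner.obj X) (f : m' ⟶ m)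
    {a b : Grid m'.dim} (h : a.Adjacent b) :
    diagonal ((sdCube 1).map f ≫ α) h = eqToHom (vertexObj_postcomp α f a) ≫
      diagonal α (h.comp f.2) ≫ eqToHom (vertexObj_postcomp α f b).symm := by
  rw [diagonal, map_eq_of_eq_comp (fun _ _ => inferInstance) (cubeFunctor_postcomp α f h) _
      (homOfLE (f.1.monotone bot_le) : f.1 ⊥ ⟶ f.1 ⊤) rfl rfl,
    cubeFunctor_map α (h.comp f.2) (homOfLE (f.1.monotone bot_le) : f.1 ⊥ ⟶ f.1 ⊤)
      (by exact (congrArg f.1.comp (gridCube_bot a b)).symm.trans (postcomp_gridCube f.1 f.2 a b ⊥))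
      (by exact (congrArg f.1.comp (gridCube_top h.1)).symm.trans (postcomp_gridCube f.1 f.2 a b ⊤))
      (h.comp f.2)]
  simp

theorem diagonal_congr (α : (sdCube.{u} 1).obj m ⟶ ner.obj X) {a b a' b' : Grid m.dim}
    (ha : a = a') (hb : b = b') (h : a.Adjacent b) (h' : a'.Adjacent b') :
    diagonal α h = eqToHom (congrArg (vertexObj α) ha) ≫ diagonal α h' ≫
      eqToHom (congrArg (vertexObj α) hb).symm := by
  subst ha hb
  simp

theorem compositeCube_postcomp (α : (sdCube.{u} 1).obj m ⟶ ner.obj X) (f : m' ⟶ m) :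
    compositeCube ((sdCube 1).map f ≫ α) = f.1.monotone.functor ⋙ compositeCube α := by
  refine CategoryTheory.Functor.ext (fun v => ?_) fun v w g => ?_
  · exact (vertexObj_postcomp α f _).trans (congrArg (vertexObj α) (Grid.comp_pair f.1 _))
  · have hvw := f.1.monotone (leOfHom g)
    change diagonal _ _ ≫ diagonal _ _ =
      eqToHom _ ≫ (diagonal α (Grid.pair_self_adjacent hvw) ≫
        diagonal α (Grid.pair_adjacent_self hvw)) ≫ eqToHom _
    rw [diagonal_postcomp, diagonal_postcomp,
      diagonal_congr α (Grid.comp_pair f.1 le_rfl) (Grid.comp_pair f.1 (leOfHom g)) _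
        (Grid.pair_self_adjacent hvw),
      diagonal_congr α (Grid.comp_pair f.1 (leOfHom g)) (Grid.comp_pair f.1 le_rfl) _
        (Grid.pair_adjacent_self hvw)]
    simp

theorem compositeCube_comp (α : (sdCube.{u} 1).obj m ⟶ ner.obj X) (H : X ⟶ Y) :
    compositeCube (α ≫ ner.map H) = compositeCube α ⋙ H.toFunctor := by
  refine CategoryTheory.Functor.hext (fun v => rfl) fun v w g => heq_of_eq ?_
  have key : ∀ {a b : Grid m.dim} (h : a.Adjacent b),
      diagonal (α ≫ ner.map H) h = H.toFunctor.map (diagonal α h) := fun h => by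
    simp only [diagonal, Functor.map_comp, eqToHom_map]
    rfl
  change diagonal (α ≫ ner.map H) _ ≫ diagonal (α ≫ ner.map H) _ = _
  rw [key, key]
  exact (H.toFunctor.map_comp _ _).symm

end Naturality

/-- Composition of two-fold subdivided cubes in the cubical nerve. -/
def nerComposition : ner.{u} ⋙ ex 1 ⟶ ner where
  app X :=
    { app := fun m => TypeCat.ofHom fun α => compositeCube α
      naturality := fun m m' f => by
        ext α
        exact compositeCube_postcomp α f.unop }
  naturality X Y H := by
    ext m α
    exact compositeCube_comp α H

theorem compositeCube_eq {X : Cat.{u, u}} {m : Cube} (α : (sdCube.{u} 1).obj m ⟶ ner.obj X) {n : ℕ}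
    (x : Box n ⥤ X) (K : Grid m.dim →o Box n)
    (h : ∀ c : LatticeHom (Box m.dim) (Grid m.dim), ∀ hc : PreservesBooleanIntervals c,
      (α.app (.op m) ⟨⟨c, hc⟩⟩ : Box m.dim ⥤ X) =
        (K.monotone.comp (OrderHomClass.mono c)).functor ⋙ x) :
    compositeCube α = (K.monotone.comp (f := fun v : Box m.dim => Grid.pair v v le_rfl)
      (fun _ _ hvw => Grid.pair_le hvw hvw)).functor ⋙ x := by
  have hV : ∀ a, vertexObj α a = x.obj (K a) := fun a => by
    refine (Functor.congr_obj (h (gridCube a a) _) ⊥).trans ?_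
    change x.obj (K (gridCube a a ⊥)) = _
    rw [gridCube_bot]
  have hD : ∀ {a b : Grid m.dim} (hab : a.Adjacent b), diagonal α hab =
      eqToHom (hV a) ≫ x.map (homOfLE (K.monotone hab.1)) ≫ eqToHom (hV b).symm := fun {a b} hab => by
    have e : cubeFunctor α a b hab = _ := h (gridCube a b) (gridCube_preserves hab)
    rw [diagonal, map_eq_of_eq_comp (fun _ _ => inferInstance) e _ (homOfLE (K.monotone hab.1))
      (congrArg K (gridCube_bot a b)) (congrArg K (gridCube_top hab.1))]
    simp
  refine CategoryTheory.Functor.ext (fun v => hV _) fun v w g => ?_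
  change diagonal _ _ ≫ diagonal _ _ = _
  rw [hD, hD, Functor.comp_map]
  simp only [Category.assoc, eqToHom_trans_assoc, eqToHom_refl, Category.id_comp]
  rw [← Functor.map_comp_assoc]
  rfl

/-- The vertex of `𝕀ᵐ` given by an element of `[1]ᵐ`. -/
def Box.vertex {m : ℕ} (v : Box m) : ICube m := fun j =>
  ⟨v.toReal j, by
    change ((v j : ℕ) : ℝ) ∈ Set.Icc (0 : ℝ) 1
    generalize v j = e
    fin_cases e <;> simp⟩

theorem Box.vertex_mono {m : ℕ} : Monotone (Box.vertex (m := m)) := fun v w h j => by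
  change ((v j : ℕ) : ℝ) ≤ ((w j : ℕ) : ℝ)
  exact_mod_cast h j

open Classical in
/-- The greatest vertex of `𝕀ⁿ` below a given point. -/
def ICube.floor {n : ℕ} : ICube n →o Box n where
  toFun t j := if t j = 1 then 1 else 0
  monotone' s t h j := by
    dsimp only
    split_ifs with h1 h2
    · exact le_rfl
    · exact absurd (le_antisymm unitInterval.le_one' (h1 ▸ h j : (1 : unitInterval) ≤ t j)) h2
    · exact Fin.zero_le _
    · exact le_rfl

theorem ICube.floor_vertex {n : ℕ} (v : Box n) : ICube.floor v.vertex = v := by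
  funext j
  change (if v.vertex j = 1 then (1 : Fin 2) else 0) = v j
  have : v.vertex j = 1 ↔ v j = 1 := by
    rw [Subtype.ext_iff]
    change ((v j : ℕ) : ℝ) = 1 ↔ _
    generalize v j = e
    fin_cases e <;> simp
  simp only [this]
  generalize v j = e
  revert e
  decide

theorem realize_map_vertex {m n : Cube} (p : m ⟶ n) (v : Box m.dim) :
    (realize.map p).toFun v.vertex = Box.vertex (p.1 v) := by
  funext i
  apply Subtype.ext
  exact affExt_vertex (p.2.isVertexMap i) v

theorem floor_realize_map {m n : Cube} (p : m ⟶ n) (t : ICube m.dim) :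
    ICube.floor ((realize.map p).toFun t : ICube n.dim) = p.1 (ICube.floor t) := by
  obtain ⟨g, -, hg⟩ := p.2.coordinates
  funext i
  rw [hg]
  have h : ((((realize.map p).toFun t : ICube n.dim) i : unitInterval) : ℝ) =
      Sum.elim (fun j => (t j : ℝ)) (fun e : Fin 2 => ((e : ℕ) : ℝ)) (g i) := by
    change affExt (fun v => ((p.1 v i : ℕ) : ℝ)) (fun j => (t j : ℝ)) = _
    simp only [affExt, hg]
    cases g i with
    | inl j =>
      rw [Finset.sum_eq_single j]
      · simp [Box.read]
      · intro l _ hl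
        simp [Box.read, hl.symm]
      · simp
    | inr e => simp [Box.read]
  change (if ((realize.map p).toFun t : ICube n.dim) i = 1 then (1 : Fin 2) else 0) = _
  have h1 : ((realize.map p).toFun t : ICube n.dim) i = 1 ↔
      Sum.elim (fun j => (t j : ℝ)) (fun e : Fin 2 => ((e : ℕ) : ℝ)) (g i) = 1 := by
    rw [Subtype.ext_iff, h]; rfl
  simp only [h1]
  cases g i with
  | inl j =>
    change _ = if t j = 1 then (1 : Fin 2) else 0
    simp only [Sum.elim_inl, Subtype.ext_iff]
    rfl
  | inr e => fin_cases e <;> simp [Box.read]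

theorem StrmHom.monotone_cube {m n : ℕ} (θ : dirCube m ⟶ dirCube n) :
    Monotone (α := ICube m) (β := ICube n) θ.toFun := fun s t h =>
  ICube.Le.le (θ.map_le ⊤ s t ⟨trivial, .single ⟨h, fun _ _ => trivial⟩⟩)

/-- The monotone function `[1]ᵐ → [1]ⁿ` that sends a vertex to the floor of its image. -/
def floorMap {m n : Cube} (θ : realize.obj m ⟶ realize.obj n) : Box m.dim →o Box n.dim :=
  ICube.floor.comp ⟨fun v => θ.toFun v.vertex, (StrmHom.monotone_cube θ).comp Box.vertex_mono⟩

theorem floorMap_id (n : Cube) : floorMap (𝟙 (realize.obj n)) = OrderHom.id := by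
  ext v : 2
  exact ICube.floor_vertex v

theorem floorMap_comp_map {l m n : Cube} (θ : realize.obj l ⟶ realize.obj m) (p : m ⟶ n) :
    floorMap (θ ≫ realize.map p) = p.1.comp (floorMap θ) := by
  ext v : 2
  exact floor_realize_map p _

theorem floorMap_map_comp {l m n : Cube} (p : l ⟶ m) (θ : realize.obj m ⟶ realize.obj n) :
    floorMap (realize.map p ≫ θ) = (floorMap θ).comp p.1 := by
  ext v : 2
  exact congrArg (fun t => ICube.floor (θ.toFun t)) (realize_map_vertex p v)

/-- The retraction of `(ner X)^♯` onto `ner X`. -/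
def nerRetraction : ner.{u} ⋙ sharp ⟶ ner where
  app X :=
    { app := fun m => TypeCat.ofHom (Quot.lift
        (fun t => ((floorMap t.2.2.down).monotone.functor ⋙ t.2.1 : Box m.unop.dim ⥤ X)) (by
          rintro _ _ ⟨p, x, a⟩
          change _ = (floorMap (a.down ≫ realize.map p)).monotone.functor ⋙ x
          simp only [floorMap_comp_map]
          rfl))
      naturality := fun m m' f => by
        ext ⟨t⟩
        change (floorMap (realize.map f.unop ≫ t.2.2.down)).monotone.functor ⋙ t.2.1 = _
        simp only [floorMap_map_comp]
        rfl }
  naturality X Y H := by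
    ext m ⟨t⟩
    rfl

theorem sharpUnit_nerRetraction (X : Cat.{u, u}) :
    sharpUnit.app (ner.obj X) ≫ nerRetraction.app X = 𝟙 (ner.obj X) := by
  ext m x
  change (floorMap (𝟙 (realize.obj m.unop))).monotone.functor ⋙ x = x
  simp only [floorMap_id]
  rfl

/-- The point of `𝕀ⁿ` that corresponds to a vertex of the subdivided cube. -/
def Grid.midpoint {n : ℕ} (a : Grid n) : ICube n := fun j =>
  ⟨(((a 0 j : ℕ) : ℝ) + ((a 1 j : ℕ) : ℝ)) / 2, by
    generalize a 0 j = p, a 1 j = q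
    change _ ∈ Set.Icc (0 : ℝ) 1
    fin_cases p <;> fin_cases q <;> norm_num⟩

theorem Grid.midpoint_mono {n : ℕ} : Monotone (Grid.midpoint (n := n)) := fun a b h j => by
  change (((a 0 j : ℕ) : ℝ) + ((a 1 j : ℕ) : ℝ)) / 2 ≤ (((b 0 j : ℕ) : ℝ) + ((b 1 j : ℕ) : ℝ)) / 2
  have h0 : ((a 0 j : ℕ) : ℝ) ≤ ((b 0 j : ℕ) : ℝ) := by exact_mod_cast h 0 j
  have h1 : ((a 1 j : ℕ) : ℝ) ≤ ((b 1 j : ℕ) : ℝ) := by exact_mod_cast h 1 j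
  linarith

theorem Grid.midpoint_pair_self {n : ℕ} (v : Box n) :
    (Grid.pair v v le_rfl).midpoint = v.vertex := by
  funext j
  apply Subtype.ext
  change (((v j : ℕ) : ℝ) + ((v j : ℕ) : ℝ)) / 2 = ((v j : ℕ) : ℝ)
  ring

theorem sdRealize_vertex {p m : Cube} (f : LatticeHom (Box p.dim) (Grid m.dim)) (v : Box p.dim) :
    (sdRealize f).toFun v.vertex = (f v).midpoint := by
  funext j
  apply Subtype.ext
  refine (affExt_vertex (isVertexMap_sd f j) v).trans ?_
  change _ = (((f v 0 j : ℕ) : ℝ) + ((f v 1 j : ℕ) : ℝ)) / 2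
  rw [Fin.sum_univ_two]
  norm_num

theorem dihomeoSharp_nerComposition (X : Cat.{u, u}) :
    (dihomeoSharp 1).app (ner.obj X) ≫ (ex 1).map (nerRetraction.app X) ≫ nerComposition.app X =
      nerRetraction.app X := by
  ext m ⟨t⟩
  obtain ⟨n, x, θ⟩ := t
  have hθ := StrmHom.monotone_cube θ.down
  let K : Grid m.unop.dim →o Box n.dim :=
    ICube.floor.comp ⟨fun a => θ.down.toFun a.midpoint, hθ.comp Grid.midpoint_mono⟩
  refine (compositeCube_eq
    ((dihomeoSing 1 m.unop θ.down ≫ kanIncl (realize ⋙ sing) (ner.obj X) x) ≫ nerRetraction.app X)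
    x K fun c hc => ?_).trans ?_
  · change (floorMap (sdRealize c ≫ θ.down)).monotone.functor ⋙ x = _
    have : floorMap (sdRealize c ≫ θ.down) = K.comp ⟨c, OrderHomClass.mono c⟩ := by
      ext v : 2
      exact congrArg (fun s => ICube.floor (θ.down.toFun s)) (sdRealize_vertex c v)
    simp only [this]
    rfl
  · change _ = (floorMap θ.down).monotone.functor ⋙ x
    have : floorMap θ.down = K.comp ⟨fun v : Box m.unop.dim => Grid.pair v v le_rfl,
        fun _ _ hvw => Grid.pair_le hvw hvw⟩ := by
      ext v : 2
      exact congrArg (fun s => ICube.floor (θ.down.toFun s)) (Grid.midpoint_pair_self v).symm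
    simp only [this]
    rfl

end Cubcat

end

theorem mainTheorem6 {G : Type u₁} [CategoryTheory.Category.{v₁} G]
    (X : CategoryTheory.Functor G CategoryTheory.Cat.{u, u}) :
    Cubcat.IsCubcat (X.comp Cubcat.ner) :=
  ⟨Functor.whiskerLeft X Cubcat.nerRetraction, Functor.whiskerLeft X Cubcat.nerComposition,
    fun g => Cubcat.sharpUnit_nerRetraction (X.obj g),
    fun g => Cubcat.dihomeoSharp_nerComposition (X.obj g)⟩
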